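/- Let $d\ge 1$ be an integer and let $A=\mathbb Z^d$ or $A=\mathbb Z_+^d$ (where $\mathbb Z_+$ may be read as the non-negative or as the positive integers). Let $\mathcal H$ be a complex Hilbert space with an orthonormal basis $(\varphi_n)_{n\in A}$, let $U$ be a unitary operator on $\mathcal H$, let $\psi\in\mathcal H$ with $\|\psi\|=1$, and let $p>0$. For $n\in A$ put $|n|=|n_1|+\dots+|n_d|$, and for $K\ge 1$ put $$\tilde a_\psi(n,K)=\frac1K\sum_{k=0}^{K-1}|\langle\varphi_n,U^k\psi\rangle|^2,\qquad \langle|X|^p_\psi\rangle(K)=\sum_{n\in A}(|n|^p+1)\,\tilde a_\psi(n,K)\in[1,\infty].$$ The upper time-averaged transport exponent is $$\tilde\beta^+_\psi(p)=\limsup_{K\to\infty}\frac{\log\langle|X|^p_\psi\rangle(K)}{p\log K}\in[0,\infty],\qquad \log\infty=\infty .$$ Let $\mu_\psi$ be the spectral measure of $U$ and $\psi$, that is, the Borel probability measure on the unit circle $\partial\mathbb D$ with $\langle\psi,f(U)\psi\rangle=\int f\,d\mu_\psi$ for every continuous $f$ on $\partial\mathbb D$. For $S\subseteq\partial\mathbb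 D$, $\delta>0$ and $\alpha\ge0$ let $p^\alpha_\delta(S)$ be the supremum of $\sum_j|I_j|^\alpha$ over all countable families of mutually disjoint closed arcs $I_j\subseteq\partial\mathbb D$ with center in $S$ and length $0<|I_j|\le\delta$, and let $$\tilde p^\alpha(S)=\inf_{\delta>0}p^\alpha_\delta(S),\qquad p^\alpha(S)=\inf\Big\{\sum_{k=1}^\infty\tilde p^\alpha(S_k):S=\bigcup_{k=1}^\infty S_k\Big\},\qquad \dim_{\mathrm P}(S)=\sup\{\alpha\ge 0:p^\alpha(S)=\infty\}$$ (with $\sup\emptyset=0$). The upper packing dimension of a finite Borel measure $\mu$ on $\partial\mathbb D$ is $$\dim^+_{\mathrm P}(\mu)=\inf\{\dim_{\mathrm P}(S):S\subseteq\partial\mathbb D\text{ Borel},\ \mu(S)=\mu(\partial\mathbb D)\}.$$ Then $$\tilde\beta^+_\psi(p)\ \ge\ \frac{\dim^+_{\mathrm P}(\mu_\psi)}{d}.$$ -/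

import Mathlib

open MeasureTheory Filter Set

open scoped ENNReal NNReal CompactlySupported

noncomputable section

namespace UnitaryTransport

/-- The unit circle `∂𝔻 = {z : |z| = 1}` in the complex plane. -/
abbrev UnitCircle : Type := Metric.sphere (0 : ℂ) 1

section SpectralMeasure

variable {H : Type*} [NormedAddCommGroup H] [InnerProductSpace ℂ H] [CompleteSpace H]

/-- The continuous functional calculus `g ↦ g(U)` of a unitary operator `U`, for continuous
functions `g : ∂𝔻 → ℂ`. -/
def unitaryCalculus (U : unitary (H →L[ℂ] H)) : C(UnitCircle, ℂ) →⋆ₐ[ℂ] (H →L[ℂ] H) :=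
  cfcHomSuperset (R := ℂ) (p := IsStarNormal) (a := (U : H →L[ℂ] H))
    (by infer_instance) (Unitary.spectrum_subset_circle U)

/-- A real-valued continuous function on the circle, regarded as complex-valued. -/
def toComplexFun (f : C_c(UnitCircle, ℝ)) : C(UnitCircle, ℂ) where
  toFun z := (f z : ℂ)
  continuous_toFun := Complex.continuous_ofReal.comp f.continuous

/-- The functional `f ↦ ⟨ψ, f(U) ψ⟩` on real-valued continuous functions on the circle. -/
def spectralLinearMap (U : unitary (H →L[ℂ] H)) (ψ : H) : C_c(UnitCircle, ℝ) →ₗ[ℝ] ℝ where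
  toFun f := (inner ℂ ψ (unitaryCalculus U (toComplexFun f) ψ)).re
  map_add' f g := by
    have h : toComplexFun (f + g) = toComplexFun f + toComplexFun g := by
      ext z; simp [toComplexFun]
    simp [h]
  map_smul' c f := by
    have h : toComplexFun (c • f) = (c : ℂ) • toComplexFun f := by
      ext z; simp [toComplexFun]
    rw [h, map_smul, smul_apply, inner_smul_right]
    simp

theorem spectralLinearMap_nonneg (U : unitary (H →L[ℂ] H)) (ψ : H) (f : C_c(UnitCircle, ℝ))
    (hf : 0 ≤ f) : 0 ≤ spectralLinearMap U ψ f := by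
  let g : C(UnitCircle, ℂ) :=
    ⟨fun z => ((Real.sqrt (f z) : ℝ) : ℂ),
      Complex.continuous_ofReal.comp (Real.continuous_sqrt.comp f.continuous)⟩
  have hg : toComplexFun f = star g * g := by
    ext z
    have hz : 0 ≤ f z := hf z
    simp only [toComplexFun, g, ContinuousMap.coe_mk, ContinuousMap.mul_apply,
      ContinuousMap.star_apply, Complex.star_def, Complex.conj_ofReal]
    rw [← Complex.ofReal_mul, Real.mul_self_sqrt hz]
  change 0 ≤ (inner ℂ ψ (unitaryCalculus U (toComplexFun f) ψ)).re
  rw [hg, map_mul, map_star, ContinuousLinearMap.star_eq_adjoint, mul_apply_eq_comp,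
    ContinuousLinearMap.adjoint_inner_right]
  exact inner_self_nonneg (𝕜 := ℂ)

/-- The spectral measure `μ_ψ^U` of the unitary operator `U` and the vector `ψ`: the Borel measure
on the circle with `⟨ψ, f(U) ψ⟩ = ∫ f dμ` for continuous `f`, obtained from the
Riesz–Markov–Kakutani theorem. -/
def spectralMeasure (U : unitary (H →L[ℂ] H)) (ψ : H) : Measure UnitCircle :=
  RealRMK.rieszMeasure
    (PositiveLinearMap.mk₀ (spectralLinearMap U ψ) (spectralLinearMap_nonneg U ψ))

end SpectralMeasure

section Packing

/-- The closed arc of the circle with center `c` and length `2 * r` (for `0 ≤ r ≤ π`). -/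
def closedArc (c : UnitCircle) (r : ℝ) : Set UnitCircle :=
  {z | ∃ φ : ℝ, |φ| ≤ r ∧ (z : ℂ) = (c : ℂ) * Complex.exp (φ * Complex.I)}

/-- A `δ`-packing with centers in `S`: a countable (possibly finite) collection of mutually disjoint
closed arcs of length at most `δ` whose centers belong to `S`. An arc is recorded as the pair
(center, half of its length). -/
structure IsPacking (δ : ℝ) (S : Set UnitCircle) (P : Set (UnitCircle × ℝ)) : Prop where
  countable : P.Countable
  center_mem : ∀ I ∈ P, I.1 ∈ S
  pos : ∀ I ∈ P, 0 < I.2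
  le_pi : ∀ I ∈ P, I.2 ≤ Real.pi
  length_le : ∀ I ∈ P, 2 * I.2 ≤ δ
  disjoint : P.PairwiseDisjoint fun I => closedArc I.1 I.2

/-- `p^α_δ(S)`: the supremum of `∑ |I|^α` over all `δ`-packings with centers in `S`. -/
def packingSup (α : ℝ≥0) (δ : ℝ) (S : Set UnitCircle) : ℝ≥0∞ :=
  ⨆ (P : Set (UnitCircle × ℝ)) (_ : IsPacking δ S P),
    ∑' I : P, ENNReal.ofReal (2 * (I : UnitCircle × ℝ).2) ^ (α : ℝ)

/-- The packing pre-measure `inf_{δ > 0} p^α_δ(S)`, which is also the limit as `δ → 0`. -/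
def packingPremeasure (α : ℝ≥0) (S : Set UnitCircle) : ℝ≥0∞ :=
  ⨅ (δ : ℝ) (_ : 0 < δ), packingSup α δ S

/-- The `α`-dimensional packing measure `p^α(S)`. -/
def packingMeasure (α : ℝ≥0) (S : Set UnitCircle) : ℝ≥0∞ :=
  ⨅ (T : ℕ → Set UnitCircle) (_ : S = ⋃ k, T k), ∑' k, packingPremeasure α (T k)

/-- The packing dimension `sup {α ≥ 0 : p^α(S) = ∞}`, with `sup ∅ = 0`. -/
def packingDim (S : Set UnitCircle) : ℝ≥0∞ :=
  ⨆ (α : ℝ≥0) (_ : packingMeasure α S = ∞), (α : ℝ≥0∞)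

/-- The upper packing dimension of a measure on the circle: the infimum of the packing dimensions
of the measurable sets of full measure. -/
def upperPackingDim (μ : Measure UnitCircle) : ℝ≥0∞ :=
  ⨅ (S : Set UnitCircle) (_ : MeasurableSet S ∧ μ S = μ univ), packingDim S

end Packing

section Transport

variable {H : Type*} [NormedAddCommGroup H] [InnerProductSpace ℂ H] [CompleteSpace H]
variable {d : ℕ} {A : Set (Fin d → ℤ)}

/-- The `ℓ¹` norm `|n| = |n₁| + ⋯ + |n_d|` on `ℤ^d`. -/
def l1Norm (n : Fin d → ℤ) : ℝ := ∑ i, |(n i : ℝ)|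

/-- `a_ψ(n, k) = |⟨φ_n, U^k ψ⟩|²`. -/
def prob (b : HilbertBasis A ℂ H) (U : unitary (H →L[ℂ] H)) (ψ : H) (n : A) (k : ℕ) : ℝ :=
  ‖inner ℂ (b n) (((U : H →L[ℂ] H) ^ k) ψ)‖ ^ 2

/-- The Cesàro averaged probability `ã_ψ(n, K) = (1 / K) ∑_{k < K} a_ψ(n, k)`. -/
def avgProb (b : HilbertBasis A ℂ H) (U : unitary (H →L[ℂ] H)) (ψ : H) (n : A) (K : ℕ) : ℝ :=
  (1 / (K : ℝ)) * ∑ k ∈ Finset.range K, prob b U ψ n k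

/-- The time-averaged moment `⟨|X|^p_ψ⟩(K) = ∑_n (|n|^p + 1) ã_ψ(n, K)`, which may be `∞`. -/
def avgMoment (b : HilbertBasis A ℂ H) (U : unitary (H →L[ℂ] H)) (ψ : H) (p : ℝ) (K : ℕ) : ℝ≥0∞ :=
  ∑' n : A, ENNReal.ofReal ((l1Norm (n : Fin d → ℤ) ^ p + 1) * avgProb b U ψ n K)

/-- The upper time-averaged transport exponent
`β̃⁺_ψ(p) = limsup_{K → ∞} log ⟨|X|^p_ψ⟩(K) / (p log K)`, with `log ∞ = ∞`. -/
def upperTransportExponent (b : HilbertBasis A ℂ H) (U : unitary (H →L[ℂ] H)) (ψ : H) (p : ℝ) :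
    EReal :=
  limsup (fun K : ℕ => ENNReal.log (avgMoment b U ψ p K) / ((p * Real.log K : ℝ) : EReal)) atTop

end Transport

end UnitaryTransport

end

/-!
Let `α < dim_P⁺(μ)`, where `μ` is the spectral measure of `U` and `ψ`. Divide the circle at scale `K`
into `K` arcs of length `2π / K`, and call such an arc heavy if its measure is at least `K^(-α)`.

*Many scales have a light part that is not too small.* If a set is covered by heavy arcs at all
dyadic scales `K = 2 ^ j` from some scale on, then comparing `|I|^α` with `μ(I)` in any packing shows
that it has packing dimension at most `α`. Were the measures of the light parts eventually bounded by
`m = 1 / (j + 1)²`, the Borel–Cantelli lemma would make such a set of full measure, so that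
`dim_P⁺(μ) ≤ α`. Hence the light part has measure larger than `m` for infinitely many `j`
(`frequently_lt_measureReal_compl_heavySet`). The loss `m` is only a power of `log K`.

*The light part spreads.* Take a continuous `f` with values in `[0, 1]`, supported in the light part
at scale `K`, with `‖(1 - f)(U) ψ‖² ≤ 1 - m`. A large sieve inequality (`exists_bound_on_gridArc`)
bounds `∫ |∑_{k < K} c_k z^k|² |f|² dμ` by a constant times `K^(1 - α) ∑ |c_k|²`.
As `g ↦ g(U) ψ` is isometric from the continuous functions with the `L²(μ)` norm, duality shows that
the time-averaged probability to find `f(U) ψ` in a given site is at most a constant times `K^(-α)`.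
Thus a cube with about `K^β` sites, `β < α`, carries little of `f(U) ψ`, and by the bound on the norm
of the rest its averaged probability is at most `1 - m / 4` (`sum_avgProb_le`). The remaining
probability sits at distance at least `K^(β / d)` from the origin, which bounds the moment below by
`K^(β p / d) m / 4` and gives the exponent (`frequently_rpow_le_avgMoment`).
-/

namespace UnitaryTransport

/-! ### A large sieve inequality on a grid of arcs -/

/-- The `i`-th of the `K` closed arcs of length `2π / K` which start at the `K`-th roots of unity. -/
def gridArc (K i : ℕ) : Set UnitCircle :=
  {z | ∃ φ ∈ Icc (0 : ℝ) (2 * Real.pi / K),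
    (z : ℂ) = Complex.exp (((2 * Real.pi * i / K + φ : ℝ) : ℂ) * Complex.I)}

/-- Parseval's identity for the discrete Fourier transform of order `K`. -/
theorem sum_norm_sq_sum_mul_rootsOfUnity {K : ℕ} (hK : 0 < K) (a : ℕ → ℂ) :
    ∑ i ∈ Finset.range K, ‖∑ k ∈ Finset.range K,
      a k * Complex.exp (2 * Real.pi * Complex.I / K) ^ (i * k)‖ ^ 2 =
      K * ∑ k ∈ Finset.range K, ‖a k‖ ^ 2 := by
  set ω := Complex.exp (2 * Real.pi * Complex.I / K) with hω
  have hprim : IsPrimitiveRoot ω K := Complex.isPrimitiveRoot_exp K hK.ne'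
  have hconj : ω * (starRingEnd ℂ) ω = 1 := by
    rw [Complex.mul_conj, Complex.normSq_eq_norm_sq, hprim.norm'_eq_one hK.ne']
    simp
  have hgeom : ∀ k ∈ Finset.range K, ∀ l ∈ Finset.range K,
      ∑ i ∈ Finset.range K, ω ^ (i * k) * (starRingEnd ℂ) (ω ^ (i * l)) =
        if k = l then (K : ℂ) else 0 := by
    intro k hk l hl
    have h1 : ∀ i, ω ^ (i * k) * (starRingEnd ℂ) (ω ^ (i * l)) =
        (ω ^ k * (starRingEnd ℂ) ω ^ l) ^ i := by
      intro i
      rw [map_pow, mul_pow, ← pow_mul, ← pow_mul, mul_comm k, mul_comm l]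
    simp_rw [h1]
    split_ifs with h
    · subst h
      rw [← mul_pow, hconj]
      simp
    · have hne : ω ^ k * (starRingEnd ℂ) ω ^ l ≠ 1 := by
        intro h2
        apply h
        apply hprim.pow_inj (Finset.mem_range.1 hk) (Finset.mem_range.1 hl)
        calc ω ^ k = ω ^ k * (ω * (starRingEnd ℂ) ω) ^ l := by rw [hconj]; simp
          _ = (ω ^ k * (starRingEnd ℂ) ω ^ l) * ω ^ l := by rw [mul_pow]; ring
          _ = ω ^ l := by rw [h2, one_mul]
      have hpow : (ω ^ k * (starRingEnd ℂ) ω ^ l) ^ K = 1 := by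
        rw [mul_pow, ← pow_mul, ← pow_mul, mul_comm k, mul_comm l, pow_mul, pow_mul, ← map_pow,
          hprim.pow_eq_one]
        simp
      have h3 := geom_sum_mul (ω ^ k * (starRingEnd ℂ) ω ^ l) K
      rw [hpow, sub_self] at h3
      exact (mul_eq_zero.1 h3).resolve_right (sub_ne_zero.2 hne)
  apply Complex.ofReal_injective
  push_cast
  simp_rw [← Complex.mul_conj', map_sum, Finset.sum_mul_sum, map_mul]
  rw [Finset.sum_comm, Finset.mul_sum]
  refine Finset.sum_congr rfl fun k hk => ?_
  rw [Finset.sum_comm]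
  calc _ = ∑ l ∈ Finset.range K, a k * (starRingEnd ℂ) (a l) *
        ∑ i ∈ Finset.range K, ω ^ (i * k) * (starRingEnd ℂ) (ω ^ (i * l)) := by
        refine Finset.sum_congr rfl fun l _ => ?_
        rw [Finset.mul_sum]
        exact Finset.sum_congr rfl fun i _ => by ring
    _ = ∑ l ∈ Finset.range K, if k = l then a k * (starRingEnd ℂ) (a l) * K else 0 := by
        refine Finset.sum_congr rfl fun l hl => ?_
        rw [hgeom k hk l hl]
        split_ifs <;> simp
    _ = _ := by
        rw [Finset.sum_ite_eq, if_pos hk, mul_comm]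

/-- The Cauchy–Schwarz inequality for infinite sums with non-negative weights. -/
theorem sq_le_mul_of_hasSum {w q : ℕ → ℝ} {W s t : ℝ} (hw : ∀ m, 0 ≤ w m) (hWpos : 0 < W)
    (hW : HasSum w W) (hs : HasSum (fun m => w m * q m) s)
    (ht : HasSum (fun m => w m * q m ^ 2) t) : s ^ 2 ≤ W * t := by
  have h : HasSum (fun m => w m * (q m - s / W) ^ 2) (t - 2 * (s / W) * s + (s / W) ^ 2 * W) := by
    have h1 := (ht.sub (hs.mul_left (2 * (s / W)))).add (hW.mul_left ((s / W) ^ 2))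
    refine h1.congr_fun fun m => ?_
    ring
  have h0 := h.nonneg fun m => mul_nonneg (hw m) (sq_nonneg _)
  have h1 : t - 2 * (s / W) * s + (s / W) ^ 2 * W = t - s ^ 2 / W := by
    field_simp
    ring
  rw [h1, sub_nonneg, div_le_iff₀ hWpos] at h0
  linarith

/-- A large sieve inequality: the squared suprema of a trigonometric polynomial of degree less than
`K` over the `K` grid arcs sum up to at most a constant times `K ∑ |c_k|²`. On each arc the
polynomial is expanded in powers of the distance to the initial point of the arc, and the values of
the coefficient polynomials at the roots of unity are controlled by Parseval's identity. -/
theorem exists_bound_on_gridArc {K : ℕ} (hK : 0 < K) (c : ℕ → ℂ) :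
    ∃ S : ℕ → ℝ, (∀ i, 0 ≤ S i) ∧
      (∀ i, ∀ z ∈ gridArc K i, ‖∑ k ∈ Finset.range K, c k * (z : ℂ) ^ k‖ ^ 2 ≤ S i) ∧
      ∑ i ∈ Finset.range K, S i ≤
        Real.exp (4 * Real.pi) * K * ∑ k ∈ Finset.range K, ‖c k‖ ^ 2 := by
  have hK' : (0 : ℝ) < K := Nat.cast_pos.2 hK
  set ω := Complex.exp (2 * Real.pi * Complex.I / K) with hω
  have hωn : ‖ω‖ = 1 := (Complex.isPrimitiveRoot_exp K hK.ne').norm'_eq_one hK.ne'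
  -- `w m` bounds the Taylor coefficient `|K φ| ^ m / m!`, as `K φ ≤ 2π` on an arc of length `2π / K`
  set w : ℕ → ℝ := fun m => (2 * Real.pi) ^ m / m.factorial with hw
  set W : ℝ := Real.exp (2 * Real.pi) with hWdef
  have hw0 : ∀ m, 0 ≤ w m := fun m => by positivity
  have hW : HasSum w W := by
    rw [hWdef, Real.exp_eq_exp_ℝ]
    exact NormedSpace.expSeries_div_hasSum_exp (2 * Real.pi)
  set Q : ℕ → ℕ → ℂ := fun m i =>
    ∑ k ∈ Finset.range K, (c k * ((k : ℂ) / K) ^ m) * ω ^ (i * k) with hQ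
  set B : ℝ := ∑ k ∈ Finset.range K, ‖c k‖ with hB
  have hkK : ∀ k ∈ Finset.range K, ∀ m : ℕ, ‖((k : ℂ) / K) ^ m‖ ≤ 1 := by
    intro k hk m
    rw [norm_pow]
    apply pow_le_one₀ (norm_nonneg _)
    rw [norm_div, Complex.norm_natCast, Complex.norm_natCast, div_le_one hK']
    exact_mod_cast (Finset.mem_range.1 hk).le
  have hQB : ∀ m i, ‖Q m i‖ ≤ B := by
    intro m i
    refine (norm_sum_le _ _).trans (Finset.sum_le_sum fun k hk => ?_)
    rw [norm_mul, norm_mul, norm_pow ω, hωn, one_pow, mul_one]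
    exact mul_le_of_le_one_right (norm_nonneg _) (hkK k hk m)
  have hs1 : ∀ i, Summable fun m => w m * ‖Q m i‖ := fun i =>
    Summable.of_nonneg_of_le (fun m => mul_nonneg (hw0 m) (norm_nonneg _))
      (fun m => mul_le_mul_of_nonneg_left (hQB m i) (hw0 m)) (hW.summable.mul_right B)
  have hs2 : ∀ i, Summable fun m => w m * ‖Q m i‖ ^ 2 := fun i =>
    Summable.of_nonneg_of_le (fun m => mul_nonneg (hw0 m) (sq_nonneg _))
      (fun m => mul_le_mul_of_nonneg_left (pow_le_pow_left₀ (norm_nonneg _) (hQB m i) 2) (hw0 m))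
      (hW.summable.mul_right (B ^ 2))
  refine ⟨fun i => W * ∑' m, w m * ‖Q m i‖ ^ 2, fun i => ?_, ?_, ?_⟩
  · exact mul_nonneg (Real.exp_pos _).le
      (tsum_nonneg fun m => mul_nonneg (hw0 m) (sq_nonneg _))
  · rintro i z ⟨φ, ⟨hφ0, hφ1⟩, hz⟩
    -- the expansion in powers of `φ`
    have hexp : HasSum (fun m : ℕ => ((K * φ : ℝ) * Complex.I) ^ m / m.factorial * Q m i)
        (∑ k ∈ Finset.range K, c k * (z : ℂ) ^ k) := by
      have hk : ∀ k ∈ Finset.range K,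
          HasSum (fun m : ℕ => ((K * φ : ℝ) * Complex.I) ^ m / m.factorial *
            ((c k * ((k : ℂ) / K) ^ m) * ω ^ (i * k))) (c k * (z : ℂ) ^ k) := by
        intro k _
        have h1 := NormedSpace.expSeries_div_hasSum_exp ((k : ℂ) * φ * Complex.I)
        rw [← Complex.exp_eq_exp_ℂ] at h1
        have h2 : (z : ℂ) ^ k = ω ^ (i * k) * Complex.exp ((k : ℂ) * φ * Complex.I) := by
          rw [hz, hω, ← Complex.exp_nat_mul, ← Complex.exp_nat_mul, ← Complex.exp_add]
          congr 1
          push_cast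
          field_simp
        rw [h2, ← mul_assoc]
        have h4 := h1.mul_left (c k * ω ^ (i * k))
        refine h4.congr_fun fun m => ?_
        have hKc : (K : ℂ) ≠ 0 := by exact_mod_cast hK.ne'
        have h3 : (k : ℂ) * φ * Complex.I = ((K * φ : ℝ) * Complex.I) * ((k : ℂ) / K) := by
          push_cast
          field_simp
        rw [h3, mul_pow _ ((k : ℂ) / K)]
        ring
      simp only [hQ, Finset.mul_sum]
      exact hasSum_sum hk
    have hbound : ‖∑ k ∈ Finset.range K, c k * (z : ℂ) ^ k‖ ≤ ∑' m, w m * ‖Q m i‖ := by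
      refine hexp.norm_le_of_bounded (hs1 i).hasSum fun m => ?_
      rw [norm_mul, norm_div, norm_pow, norm_mul, Complex.norm_I, mul_one, Complex.norm_real,
        Complex.norm_natCast, Real.norm_of_nonneg (by positivity)]
      have h4 : K * φ ≤ 2 * Real.pi := by
        rw [le_div_iff₀ hK'] at hφ1
        linarith
      simp only [hw]
      gcongr
    calc ‖∑ k ∈ Finset.range K, c k * (z : ℂ) ^ k‖ ^ 2 ≤ (∑' m, w m * ‖Q m i‖) ^ 2 :=
          pow_le_pow_left₀ (norm_nonneg _) hbound 2
      _ ≤ _ := sq_le_mul_of_hasSum hw0 (Real.exp_pos _) hW (hs1 i).hasSum (hs2 i).hasSum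
  · rw [← Finset.mul_sum, ← Summable.tsum_finsetSum fun i _ => hs2 i]
    have hpar : ∀ m, ∑ i ∈ Finset.range K, w m * ‖Q m i‖ ^ 2 ≤
        w m * (K * ∑ k ∈ Finset.range K, ‖c k‖ ^ 2) := by
      intro m
      rw [← Finset.mul_sum]
      refine mul_le_mul_of_nonneg_left ?_ (hw0 m)
      rw [sum_norm_sq_sum_mul_rootsOfUnity hK]
      refine mul_le_mul_of_nonneg_left (Finset.sum_le_sum fun k hk => ?_) hK'.le
      rw [norm_mul]
      exact pow_le_pow_left₀ (by positivity)
        (mul_le_of_le_one_right (norm_nonneg _) (hkK k hk m)) 2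
    have h5 : ∑' m, ∑ i ∈ Finset.range K, w m * ‖Q m i‖ ^ 2 ≤
        W * (K * ∑ k ∈ Finset.range K, ‖c k‖ ^ 2) :=
      (Summable.tsum_le_tsum hpar (summable_sum fun i _ => hs2 i)
        (hW.summable.mul_right _)).trans_eq (hW.mul_right _).tsum_eq
    calc _ ≤ W * (W * (K * ∑ k ∈ Finset.range K, ‖c k‖ ^ 2)) :=
          mul_le_mul_of_nonneg_left h5 (Real.exp_pos _).le
      _ = _ := by
          rw [show 4 * Real.pi = 2 * Real.pi + 2 * Real.pi by ring, Real.exp_add]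
          ring

theorem isCompact_gridArc (K i : ℕ) : IsCompact (gridArc K i) := by
  let g : ℝ → UnitCircle := fun φ =>
    ⟨Complex.exp (((2 * Real.pi * i / K + φ : ℝ) : ℂ) * Complex.I), by
      rw [mem_sphere_zero_iff_norm, Complex.norm_exp_ofReal_mul_I]⟩
  have hg : Continuous g := by
    apply Continuous.subtype_mk
    fun_prop
  have h : gridArc K i = g '' Icc (0 : ℝ) (2 * Real.pi / K) := by
    ext z
    simp only [gridArc, mem_ofPred_eq, mem_image, g, Subtype.ext_iff]
    exact exists_congr fun φ => and_congr_right fun _ => eq_comm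
  rw [h]
  exact isCompact_Icc.image hg

theorem exists_mem_gridArc {K : ℕ} (hK : 0 < K) (z : UnitCircle) :
    ∃ i ∈ Finset.range K, z ∈ gridArc K i := by
  have hK' : (0 : ℝ) < K := Nat.cast_pos.2 hK
  have hpi := Real.pi_pos
  obtain ⟨θ, ⟨hθ0, hθ1⟩, hθ⟩ : ∃ θ ∈ Ico (0 : ℝ) (2 * Real.pi),
      (z : ℂ) = Complex.exp ((θ : ℂ) * Complex.I) := by
    have hz : (z : ℂ) = Complex.exp ((Complex.arg (z : ℂ) : ℂ) * Complex.I) := by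
      conv_lhs => rw [← Complex.norm_mul_exp_arg_mul_I (z : ℂ)]
      rw [mem_sphere_zero_iff_norm.1 z.2]
      simp
    have h1 := Complex.neg_pi_lt_arg (z : ℂ)
    have h2 := Complex.arg_le_pi (z : ℂ)
    by_cases h : 0 ≤ Complex.arg (z : ℂ)
    · exact ⟨_, ⟨h, by linarith⟩, hz⟩
    · refine ⟨Complex.arg (z : ℂ) + 2 * Real.pi, ⟨by linarith, by linarith⟩, ?_⟩
      push_cast
      rw [add_mul, Complex.exp_add, Complex.exp_two_pi_mul_I, mul_one]
      exact hz
  have hx0 : 0 ≤ θ * K / (2 * Real.pi) := by positivity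
  refine ⟨⌊θ * K / (2 * Real.pi)⌋₊, ?_, θ - 2 * Real.pi * ⌊θ * K / (2 * Real.pi)⌋₊ / K,
    ⟨?_, ?_⟩, ?_⟩
  · rw [Finset.mem_range, Nat.floor_lt hx0, div_lt_iff₀ (by positivity)]
    nlinarith
  · have := Nat.floor_le hx0
    rw [le_div_iff₀ (by positivity)] at this
    rw [sub_nonneg, div_le_iff₀ hK']
    linarith
  · have := Nat.lt_floor_add_one (θ * K / (2 * Real.pi))
    rw [div_lt_iff₀ (by positivity)] at this
    rw [sub_le_iff_le_add, ← add_div, le_div_iff₀ hK']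
    linarith
  · rw [hθ]
    congr 3
    ring

theorem gridArc_subset_closedArc {K i : ℕ} {x : UnitCircle} (hx : x ∈ gridArc K i) :
    gridArc K i ⊆ closedArc x (2 * Real.pi / K) := by
  rintro z ⟨φ, hφ, hz⟩
  obtain ⟨θ, hθ, hx⟩ := hx
  refine ⟨φ - θ, abs_le.2 ⟨by linarith [hφ.1, hθ.2], by linarith [hφ.2, hθ.1]⟩, ?_⟩
  rw [hz, hx, ← Complex.exp_add]
  congr 1
  push_cast
  ring

/-! ### Heavy and light parts of the circle -/

/-- The union of those among the `K` grid arcs that have measure at least `c`. -/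
def heavySet (μ : Measure UnitCircle) (K : ℕ) (c : ℝ) : Set UnitCircle :=
  ⋃ i ∈ {i ∈ Finset.range K | c ≤ μ.real (gridArc K i)}, gridArc K i

theorem isClosed_heavySet (μ : Measure UnitCircle) (K : ℕ) (c : ℝ) :
    IsClosed (heavySet μ K c) :=
  isClosed_biUnion_finset fun _ _ => (isCompact_gridArc _ _).isClosed

theorem le_measureReal_closedArc_of_mem_heavySet {μ : Measure UnitCircle} [IsFiniteMeasure μ]
    {K : ℕ} {c : ℝ} {x : UnitCircle} (hx : x ∈ heavySet μ K c) :
    c ≤ μ.real (closedArc x (2 * Real.pi / K)) := by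
  simp only [heavySet, mem_iUnion, Finset.mem_filter] at hx
  obtain ⟨i, ⟨-, hi⟩, hx⟩ := hx
  exact hi.trans (measureReal_mono (gridArc_subset_closedArc hx))

/-- Away from the heavy arcs, the `L²` norm of a trigonometric polynomial of degree less than `K` is
controlled by the `ℓ²` norm of its coefficients. -/
theorem setIntegral_compl_heavySet_le {μ : Measure UnitCircle} [IsFiniteMeasure μ] {K : ℕ}
    (hK : 0 < K) {c : ℝ} (hc : 0 ≤ c) (a : ℕ → ℂ) :
    ∫ z in (heavySet μ K c)ᶜ, ‖∑ k ∈ Finset.range K, a k * (z : ℂ) ^ k‖ ^ 2 ∂μ ≤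
      c * (Real.exp (4 * Real.pi) * K * ∑ k ∈ Finset.range K, ‖a k‖ ^ 2) := by
  obtain ⟨S, hS0, hS1, hS2⟩ := exists_bound_on_gridArc hK a
  have hmeas : ∀ i, MeasurableSet (gridArc K i) := fun i => (isCompact_gridArc K i).measurableSet
  have hint : ∀ i, Integrable ((gridArc K i).indicator fun _ => S i) μ := fun i =>
    (integrable_const _).indicator (hmeas i)
  set s := {i ∈ Finset.range K | ¬ c ≤ μ.real (gridArc K i)} with hs
  rw [← integral_indicator (isClosed_heavySet μ K c).isOpen_compl.measurableSet]
  calc _ ≤ ∫ z, ∑ i ∈ s, (gridArc K i).indicator (fun _ => S i) z ∂μ := by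
        refine integral_mono_of_nonneg (Eventually.of_forall fun z => ?_)
          (integrable_finsetSum _ fun i _ => hint i) (Eventually.of_forall fun z => ?_)
        · exact indicator_nonneg (fun _ _ => sq_nonneg _) z
        · have hnn : ∀ i ∈ s, 0 ≤ (gridArc K i).indicator (fun _ => S i) z := fun i _ =>
            indicator_nonneg (fun _ _ => hS0 i) z
          refine indicator_apply_le' (fun hz => ?_) fun _ => Finset.sum_nonneg hnn
          obtain ⟨i, hi, hzi⟩ := exists_mem_gridArc hK z
          have his : i ∈ s := by
            refine Finset.mem_filter.2 ⟨hi, fun hci => hz ?_⟩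
            simp only [heavySet, mem_iUnion, Finset.mem_filter]
            exact ⟨i, ⟨hi, hci⟩, hzi⟩
          refine le_trans ?_ (Finset.single_le_sum hnn his)
          rw [indicator_of_mem hzi]
          exact hS1 i z hzi
    _ = ∑ i ∈ s, μ.real (gridArc K i) * S i := by
        rw [integral_finsetSum _ fun i _ => hint i]
        refine Finset.sum_congr rfl fun i _ => ?_
        rw [integral_indicator_const _ (hmeas i), smul_eq_mul]
    _ ≤ ∑ i ∈ s, c * S i := Finset.sum_le_sum fun i hi =>
        mul_le_mul_of_nonneg_right (not_le.1 (Finset.mem_filter.1 hi).2).le (hS0 i)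
    _ ≤ ∑ i ∈ Finset.range K, c * S i := Finset.sum_le_sum_of_subset_of_nonneg
        (Finset.filter_subset _ _) fun i _ _ => mul_nonneg hc (hS0 i)
    _ ≤ _ := by
        rw [← Finset.mul_sum]
        exact mul_le_mul_of_nonneg_left hS2 hc

/-! ### The packing dimension of sets on which a measure is heavy -/

theorem isCompact_closedArc (c : UnitCircle) (r : ℝ) : IsCompact (closedArc c r) := by
  let g : ℝ → UnitCircle := fun φ =>
    ⟨(c : ℂ) * Complex.exp ((φ : ℂ) * Complex.I), by
      rw [mem_sphere_zero_iff_norm, norm_mul, Complex.norm_exp_ofReal_mul_I,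
        mem_sphere_zero_iff_norm.1 c.2, one_mul]⟩
  have hg : Continuous g := by
    apply Continuous.subtype_mk
    fun_prop
  have h : closedArc c r = g '' Icc (-r) r := by
    ext z
    simp only [closedArc, mem_ofPred_eq, mem_image, g, Subtype.ext_iff, mem_Icc, abs_le]
    exact exists_congr fun φ => and_congr_right fun _ => eq_comm
  rw [h]
  exact isCompact_Icc.image hg

theorem closedArc_mono (c : UnitCircle) {r s : ℝ} (h : r ≤ s) : closedArc c r ⊆ closedArc c s :=
  fun _ ⟨φ, hφ, hz⟩ => ⟨φ, hφ.trans h, hz⟩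

/-- If every arc of radius at most `δ / 2` with center in `T` satisfies `|I|^α ≤ C μ(I)`, then
every `δ`-packing of `T` has at most the total weight `C μ(∂𝔻)`. -/
theorem packingSup_le_of_forall_le {μ : Measure UnitCircle} {T : Set UnitCircle} {α : ℝ≥0}
    {δ : ℝ} {C : ℝ≥0∞}
    (h : ∀ x ∈ T, ∀ r : ℝ, 0 < r → 2 * r ≤ δ →
      ENNReal.ofReal (2 * r) ^ (α : ℝ) ≤ C * μ (closedArc x r)) :
    packingSup α δ T ≤ C * μ univ := by
  refine iSup₂_le fun P hP => ?_
  have : Countable P := hP.countable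
  calc ∑' I : P, ENNReal.ofReal (2 * (I : UnitCircle × ℝ).2) ^ (α : ℝ)
      ≤ ∑' I : P, C * μ (closedArc (I : UnitCircle × ℝ).1 (I : UnitCircle × ℝ).2) :=
        ENNReal.tsum_le_tsum fun I =>
          h _ (hP.center_mem I I.2) _ (hP.pos I I.2) (hP.length_le I I.2)
    _ = C * μ (⋃ I : P, closedArc (I : UnitCircle × ℝ).1 (I : UnitCircle × ℝ).2) := by
        rw [ENNReal.tsum_mul_left, measure_iUnion]
        · exact fun I J hIJ => hP.disjoint I.2 J.2 fun h => hIJ (Subtype.ext h)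
        · exact fun I => (isCompact_closedArc _ _).measurableSet
    _ ≤ C * μ univ := by gcongr; exact subset_univ _

/-- The packing pre-measure jumps from a finite value to zero when the exponent increases, because
`|I|^β ≤ δ^(β - α) |I|^α` for arcs of length at most `δ`. -/
theorem packingPremeasure_eq_zero_of_lt {α β : ℝ≥0} (hαβ : α < β) {T : Set UnitCircle}
    (h : packingPremeasure α T ≠ ∞) : packingPremeasure β T = 0 := by
  obtain ⟨δ₀, hδ₀, hlt⟩ : ∃ δ : ℝ, 0 < δ ∧ packingSup α δ T < ∞ := by
    simpa [packingPremeasure, lt_top_iff_ne_top, iInf_eq_top] using h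
  have hβα : 0 < (β : ℝ) - α := sub_pos.2 (by exact_mod_cast hαβ)
  have hle : ∀ δ : ℝ, 0 < δ → δ ≤ δ₀ →
      packingPremeasure β T ≤ ENNReal.ofReal δ ^ ((β : ℝ) - α) * packingSup α δ₀ T := by
    intro δ hδ hδδ₀
    refine (iInf₂_le δ hδ).trans (iSup₂_le fun P hP => ?_)
    have hP' : IsPacking δ₀ T P := { hP with length_le := fun I hI => (hP.length_le I hI).trans hδδ₀ }
    refine le_trans ?_ (mul_le_mul_right (le_iSup₂_of_le P hP' le_rfl) _)
    rw [← ENNReal.tsum_mul_left]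
    refine ENNReal.tsum_le_tsum fun I => ?_
    have hI : ENNReal.ofReal (2 * (I : UnitCircle × ℝ).2) ≠ 0 := by
      simpa using hP.pos I I.2
    calc ENNReal.ofReal (2 * (I : UnitCircle × ℝ).2) ^ (β : ℝ)
        = ENNReal.ofReal (2 * (I : UnitCircle × ℝ).2) ^ ((β : ℝ) - α) *
          ENNReal.ofReal (2 * (I : UnitCircle × ℝ).2) ^ (α : ℝ) := by
          rw [← ENNReal.rpow_add _ _ hI ENNReal.ofReal_ne_top, sub_add_cancel]
      _ ≤ _ := by
          gcongr
          exact hP.length_le I I.2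
  have htend : Tendsto (fun δ : ℝ => ENNReal.ofReal δ ^ ((β : ℝ) - α) * packingSup α δ₀ T)
      (nhdsWithin 0 (Ioi 0)) (nhds 0) := by
    have h1 : Tendsto (fun δ : ℝ => ENNReal.ofReal δ ^ ((β : ℝ) - α)) (nhds 0) (nhds 0) := by
      have hcont : Continuous fun δ : ℝ => ENNReal.ofReal δ ^ ((β : ℝ) - α) :=
        (ENNReal.continuous_rpow_const).comp ENNReal.continuous_ofReal
      have := hcont.tendsto 0
      rwa [ENNReal.ofReal_zero, ENNReal.zero_rpow_of_pos hβα] at this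
    have h2 := ENNReal.Tendsto.mul_const (h1.mono_left (nhdsWithin_le_nhds (s := Ioi 0)))
      (Or.inr hlt.ne : (0 : ℝ≥0∞) ≠ 0 ∨ packingSup α δ₀ T ≠ ∞)
    rwa [zero_mul] at h2
  refine le_antisymm (ge_of_tendsto htend ?_) bot_le
  filter_upwards [Ioc_mem_nhdsGT hδ₀] with δ hδ using hle δ hδ.1 hδ.2

theorem packingDim_iUnion_le {α : ℝ≥0} {T : ℕ → Set UnitCircle}
    (h : ∀ k, packingPremeasure α (T k) ≠ ∞) : packingDim (⋃ k, T k) ≤ α := by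
  refine iSup₂_le fun β hβ => ?_
  by_contra hlt
  have hαβ : α < β := by exact_mod_cast not_le.1 hlt
  have h0 : packingMeasure β (⋃ k, T k) ≤ 0 := by
    refine iInf_le_of_le T (iInf_le_of_le rfl ?_)
    simp [packingPremeasure_eq_zero_of_lt hαβ (h _)]
  simp [hβ] at h0

/-- The points that lie in the heavy part of the circle for all dyadic scales from some scale on
form a set of packing dimension at most `α`, if heaviness at scale `K` means measure at least
`K^(-α)`. -/
theorem packingDim_iUnion_iInter_heavySet_le (μ : Measure UnitCircle) [IsFiniteMeasure μ]
    (α : ℝ≥0) :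
    packingDim (⋃ J : ℕ, ⋂ j ≥ J, heavySet μ (2 ^ j) ((2 ^ j : ℝ) ^ (-(α : ℝ)))) ≤ α := by
  refine packingDim_iUnion_le fun J => ne_top_of_le_ne_top (b := _) ?_
    ((iInf₂_le (4 * Real.pi / 2 ^ J) (by positivity)).trans
      (packingSup_le_of_forall_le (μ := μ)
        (C := ENNReal.ofReal ((8 * Real.pi) ^ (α : ℝ))) fun x hx r hr hrδ => ?_))
  · exact ENNReal.mul_ne_top ENNReal.ofReal_ne_top (measure_ne_top μ _)
  -- The dyadic scale with `2π / 2 ^ (n + 1) < r ≤ 2π / 2 ^ n`: the arc of radius `r` then contains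
  -- a heavy arc of measure at least `2 ^ (-(n + 1) α)`, while `2 r ≤ 8π / 2 ^ (n + 1)`.
  have hpi := Real.pi_pos
  have hrJ : r / (2 * Real.pi) ≤ (1 / 2) ^ J := by
    rw [div_le_iff₀ (by positivity), one_div, inv_pow]
    calc r ≤ (4 * Real.pi / 2 ^ J) / 2 := by linarith
      _ = _ := by ring
  obtain ⟨n, hn1, hn2⟩ := exists_nat_pow_near_of_lt_one (x := r / (2 * Real.pi))
    (y := (1 / 2 : ℝ)) (by positivity) (hrJ.trans (pow_le_one₀ (by norm_num) (by norm_num)))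
    (by norm_num) (by norm_num)
  have hJn : J ≤ n + 1 := ((pow_lt_pow_iff_right_of_lt_one₀ (by norm_num : (0 : ℝ) < 1 / 2)
    (by norm_num)).1 (hn1.trans_le hrJ)).le
  have hx' := mem_iInter₂.1 hx (n + 1) hJn
  have h1 : (2 ^ (n + 1) : ℝ) ^ (-(α : ℝ)) ≤ μ.real (closedArc x r) := by
    refine (le_measureReal_closedArc_of_mem_heavySet hx').trans
      (measureReal_mono (closedArc_mono x ?_))
    rw [lt_div_iff₀ (by positivity), one_div, inv_pow] at hn1
    push_cast
    rw [div_eq_mul_inv]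
    linarith
  have h2 : (2 * r) ^ (α : ℝ) ≤ (8 * Real.pi) ^ (α : ℝ) * (2 ^ (n + 1) : ℝ) ^ (-(α : ℝ)) := by
    rw [Real.rpow_neg (by positivity), ← div_eq_mul_inv, ← Real.div_rpow (by positivity)
      (by positivity)]
    refine Real.rpow_le_rpow (by positivity) ?_ α.2
    rw [div_le_iff₀ (by positivity), one_div, inv_pow] at hn2
    rw [pow_succ, le_div_iff₀ (by positivity)]
    have h3 : (2 ^ n : ℝ)⁻¹ * 2 ^ n = 1 := inv_mul_cancel₀ (by positivity)
    have h4 := mul_le_mul_of_nonneg_right hn2 (by positivity : (0 : ℝ) ≤ 2 ^ n)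
    nlinarith
  rw [ENNReal.ofReal_rpow_of_pos (by positivity)]
  refine (ENNReal.ofReal_le_ofReal h2).trans ?_
  rw [ENNReal.ofReal_mul (by positivity)]
  gcongr
  rw [← ofReal_measureReal]
  exact ENNReal.ofReal_le_ofReal h1

/-- If `α` is smaller than the upper packing dimension of `μ`, then by the Borel–Cantelli lemma
there are infinitely many dyadic scales at which the light part of the circle has a measure that is
not too small. -/
theorem frequently_lt_measureReal_compl_heavySet {μ : Measure UnitCircle} [IsFiniteMeasure μ]
    {α : ℝ≥0} (hα : α < upperPackingDim μ) :
    ∃ᶠ j : ℕ in atTop, 1 / ((j : ℝ) + 1) ^ 2 <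
      μ.real (heavySet μ (2 ^ j) ((2 ^ j : ℝ) ^ (-(α : ℝ))))ᶜ := by
  intro hev
  refine hα.not_ge ((iInf₂_le _ ⟨?_, ?_⟩).trans (packingDim_iUnion_iInter_heavySet_le μ α))
  · exact .iUnion fun J => .iInter fun j => .iInter fun _ => (isClosed_heavySet _ _ _).measurableSet
  · have hsum : Summable fun j : ℕ =>
        μ.real (heavySet μ (2 ^ j) ((2 ^ j : ℝ) ^ (-(α : ℝ))))ᶜ := by
      have h1 : Summable fun j : ℕ => 1 / ((j : ℝ) + 1) ^ 2 := by
        have := (summable_nat_add_iff 1).2 (Real.summable_one_div_nat_pow.2 one_lt_two)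
        simpa using this
      refine h1.of_norm_bounded_eventually_nat ?_
      filter_upwards [hev] with j hj
      rw [Real.norm_of_nonneg measureReal_nonneg]
      exact not_lt.1 hj
    have hlim := measure_limsup_atTop_eq_zero (μ := μ)
      (s := fun j : ℕ => (heavySet μ (2 ^ j) ((2 ^ j : ℝ) ^ (-(α : ℝ))))ᶜ) ?_
    · refine measure_of_measure_compl_eq_zero ?_
      convert hlim using 2
      rw [limsup_eq_iInf_iSup_of_nat]
      simp [compl_iUnion, compl_iInter]
    · have := hsum.tsum_ofReal_ne_top
      simpa [measureReal_def, ENNReal.ofReal_toReal] using this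

/-! ### The spectral measure -/

section SpectralMeasure

variable {H : Type*} [NormedAddCommGroup H] [InnerProductSpace ℂ H] [CompleteSpace H]

instance isFiniteMeasure_spectralMeasure (U : unitary (H →L[ℂ] H)) (ψ : H) :
    IsFiniteMeasure (spectralMeasure U ψ) := by
  unfold spectralMeasure
  infer_instance

/-- The map `g ↦ g(U) ψ` is isometric for the `L²` norm of the spectral measure. -/
theorem norm_sq_unitaryCalculus_apply (U : unitary (H →L[ℂ] H)) (ψ : H) (g : C(UnitCircle, ℂ)) :
    ‖unitaryCalculus U g ψ‖ ^ 2 = ∫ z, ‖g z‖ ^ 2 ∂(spectralMeasure U ψ) := by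
  let f : C_c(UnitCircle, ℝ) :=
    ⟨⟨fun z => ‖g z‖ ^ 2, by fun_prop⟩, HasCompactSupport.of_compactSpace _⟩
  have hf : toComplexFun f = star g * g := by
    ext z
    simp only [toComplexFun, f, ContinuousMap.coe_mk, ContinuousMap.mul_apply,
      ContinuousMap.star_apply, Complex.star_def, Complex.conj_mul']
    exact Complex.ofReal_pow _ _
  have h1 := RealRMK.integral_rieszMeasure
    (PositiveLinearMap.mk₀ (spectralLinearMap U ψ) (spectralLinearMap_nonneg U ψ)) f
  have h2 : spectralLinearMap U ψ f = ‖unitaryCalculus U g ψ‖ ^ 2 := by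
    change (inner ℂ ψ (unitaryCalculus U (toComplexFun f) ψ)).re = _
    rw [hf, map_mul, map_star, ContinuousLinearMap.star_eq_adjoint, mul_apply_eq_comp,
      ContinuousLinearMap.adjoint_inner_right]
    exact inner_self_eq_norm_sq (𝕜 := ℂ) _
  exact h2.symm.trans h1.symm

theorem measureReal_spectralMeasure_univ (U : unitary (H →L[ℂ] H)) (ψ : H) :
    (spectralMeasure U ψ).real univ = ‖ψ‖ ^ 2 := by
  have h := norm_sq_unitaryCalculus_apply U ψ 1
  simpa using h.symm

/-- The inclusion of the circle into the complex plane, as a continuous function. -/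
noncomputable def circleCoord : C(UnitCircle, ℂ) := .restrict _ (.id ℂ)

theorem unitaryCalculus_circleCoord (U : unitary (H →L[ℂ] H)) :
    unitaryCalculus U circleCoord = (U : H →L[ℂ] H) :=
  cfcHomSuperset_id _ _

/-! ### Decay of time-averaged probabilities -/

/-- Duality: the synthesis map `c ↦ ∑ c_k v_k` and its adjoint `φ ↦ (⟨v_k, φ⟩)_k` have the same
norm. -/
theorem sum_norm_inner_sq_le {ι E : Type*} [NormedAddCommGroup E] [InnerProductSpace ℂ E]
    (s : Finset ι) (v : ι → E) {B : ℝ} (hB : 0 ≤ B)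
    (h : ∀ c : ι → ℂ, ‖∑ k ∈ s, c k • v k‖ ^ 2 ≤ B * ∑ k ∈ s, ‖c k‖ ^ 2) (φ : E) :
    ∑ k ∈ s, ‖inner ℂ φ (v k)‖ ^ 2 ≤ B * ‖φ‖ ^ 2 := by
  set S := ∑ k ∈ s, ‖inner ℂ φ (v k)‖ ^ 2 with hS
  have hS0 : 0 ≤ S := Finset.sum_nonneg fun _ _ => sq_nonneg _
  set x := ∑ k ∈ s, (inner ℂ (v k) φ : ℂ) • v k with hx
  have h1 : ‖x‖ ^ 2 ≤ B * S := by
    refine (h fun k => inner ℂ (v k) φ).trans_eq ?_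
    simp_rw [hS, norm_inner_symm]
  have h2 : (S : ℂ) = inner ℂ φ x := by
    rw [hx, inner_sum, hS]
    push_cast
    refine Finset.sum_congr rfl fun k _ => ?_
    rw [inner_smul_right, ← inner_conj_symm φ, Complex.mul_conj', RCLike.norm_conj]
  have h3 : S ≤ ‖φ‖ * ‖x‖ := by
    have h4 := norm_inner_le_norm (𝕜 := ℂ) φ x
    rwa [← h2, Complex.norm_real, Real.norm_of_nonneg hS0] at h4
  have h5 : S * S ≤ (B * ‖φ‖ ^ 2) * S := by
    calc S * S ≤ (‖φ‖ * ‖x‖) * (‖φ‖ * ‖x‖) := mul_self_le_mul_self hS0 h3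
      _ = ‖φ‖ ^ 2 * ‖x‖ ^ 2 := by ring
      _ ≤ ‖φ‖ ^ 2 * (B * S) := by gcongr
      _ = _ := by ring
  rcases hS0.eq_or_lt with h0 | h0
  · rw [← h0]
    positivity
  · exact le_of_mul_le_mul_right h5 h0

/-- For a function `f` supported in the light part of the circle at scale `K`, the probability to
find the evolution of `f(U) ψ` in a given state decays on time average. -/
theorem sum_norm_inner_pow_unitaryCalculus_sq_le (U : unitary (H →L[ℂ] H)) (ψ : H) {K : ℕ}
    (hK : 0 < K) {c : ℝ} (hc : 0 ≤ c) (f : C(UnitCircle, ℂ)) (hf1 : ∀ z, ‖f z‖ ≤ 1)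
    (hf0 : ∀ z ∈ heavySet (spectralMeasure U ψ) K c, f z = 0) (φ : H) :
    ∑ k ∈ Finset.range K, ‖inner ℂ φ (((U : H →L[ℂ] H) ^ k) (unitaryCalculus U f ψ))‖ ^ 2 ≤
      c * (Real.exp (4 * Real.pi) * K) * ‖φ‖ ^ 2 := by
  refine sum_norm_inner_sq_le _ _ (by positivity) (fun a => ?_) φ
  set g : C(UnitCircle, ℂ) := (∑ k ∈ Finset.range K, a k • circleCoord ^ k) * f with hg
  have h1 : ∑ k ∈ Finset.range K, a k • ((U : H →L[ℂ] H) ^ k) (unitaryCalculus U f ψ) =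
      unitaryCalculus U g ψ := by
    rw [hg, map_mul, mul_apply_eq_comp, map_sum, sum_apply]
    refine Finset.sum_congr rfl fun k _ => ?_
    rw [map_smul, map_pow, unitaryCalculus_circleCoord, smul_apply]
  have hgz : ∀ z, g z = (∑ k ∈ Finset.range K, a k * (z : ℂ) ^ k) * f z := by
    intro z
    simp [hg, circleCoord]
  rw [h1, norm_sq_unitaryCalculus_apply, mul_assoc, mul_assoc, ← mul_assoc (Real.exp _)]
  refine le_trans ?_ (setIntegral_compl_heavySet_le (μ := spectralMeasure U ψ) hK hc a)
  rw [← integral_indicator (isClosed_heavySet _ K c).isOpen_compl.measurableSet]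
  refine integral_mono_of_nonneg (Eventually.of_forall fun z => sq_nonneg _) ?_
    (Eventually.of_forall fun z => ?_)
  · refine Integrable.indicator ?_ (isClosed_heavySet _ K c).isOpen_compl.measurableSet
    exact Continuous.integrable_of_hasCompactSupport (by fun_prop)
      (HasCompactSupport.of_compactSpace _)
  · by_cases hz : z ∈ heavySet (spectralMeasure U ψ) K c
    · simp [hgz, hf0 z hz, hz]
    · rw [indicator_of_mem hz]
      simp only [hgz, norm_mul]
      exact pow_le_pow_left₀ (by positivity) (mul_le_of_le_one_right (norm_nonneg _) (hf1 z)) 2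

theorem norm_pow_unitary_apply (U : unitary (H →L[ℂ] H)) (k : ℕ) (x : H) :
    ‖((U : H →L[ℂ] H) ^ k) x‖ = ‖x‖ := by
  have h : ((U : H →L[ℂ] H) ^ k) = ((U ^ k : unitary (H →L[ℂ] H)) : H →L[ℂ] H) := by simp
  rw [h]
  exact Unitary.norm_map _ _

end SpectralMeasure

section Transport

variable {H : Type*} [NormedAddCommGroup H] [InnerProductSpace ℂ H] [CompleteSpace H]
variable {d : ℕ} {A : Set (Fin d → ℤ)}

/-- On time average, the probability to stay in a finite set `Λ` of sites is not close to one if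
the light part of the circle at scale `K` has mass more than `m`. Split `ψ = f(U) ψ + (1 - f)(U) ψ`
with `f` supported in the light part: the first vector contributes little to the probability, by
the large sieve inequality, and the second vector has norm at most `√(1 - m)`. -/
theorem sum_avgProb_le (b : HilbertBasis A ℂ H) (U : unitary (H →L[ℂ] H)) {ψ : H} (hψ : ‖ψ‖ = 1)
    {K : ℕ} (hK : 0 < K) {c : ℝ} (hc : 0 ≤ c) {m t : ℝ} (hm0 : 0 ≤ m) (ht : 0 < t)
    (hm : m < (spectralMeasure U ψ).real (heavySet (spectralMeasure U ψ) K c)ᶜ)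
    (Λ : Finset A) :
    ∑ n ∈ Λ, avgProb b U ψ n K ≤
      (1 + t) * (1 - m) + (1 + 1 / t) * (Λ.card * (c * Real.exp (4 * Real.pi))) := by
  have hK' : (0 : ℝ) < K := Nat.cast_pos.2 hK
  set μ := spectralMeasure U ψ with hμ
  have hopen : IsOpen (heavySet μ K c)ᶜ := (isClosed_heavySet μ K c).isOpen_compl
  -- Inner regularity and Urysohn's lemma avoid applying an indicator function to `U`.
  obtain ⟨F, hFsub, hF, hmF⟩ : ∃ F ⊆ (heavySet μ K c)ᶜ, IsCompact F ∧ ENNReal.ofReal m < μ F := by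
    refine hopen.exists_lt_isCompact ?_
    rw [← ofReal_measureReal]
    exact (ENNReal.ofReal_lt_ofReal_iff (hm0.trans_lt hm)).2 hm
  have hmF' : m ≤ μ.real F := by
    rw [← ofReal_measureReal] at hmF
    exact (lt_of_not_ge fun h => hmF.not_ge (ENNReal.ofReal_le_ofReal h)).le
  obtain ⟨u, hu1, hu0, -, hu⟩ := exists_continuous_one_zero_of_isCompact hF
    (isClosed_heavySet μ K c) (disjoint_left.2 fun z hz => hFsub hz)
  set f : C(UnitCircle, ℂ) := ⟨fun z => (u z : ℂ), by fun_prop⟩ with hf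
  have hfn : ∀ z, ‖f z‖ ≤ 1 := fun z => by
    simpa [hf, abs_of_nonneg (hu z).1] using (hu z).2
  set x := unitaryCalculus U f ψ with hx
  set y := unitaryCalculus U (1 - f) ψ with hy
  have hxy : x + y = ψ := by
    rw [hx, hy, map_sub, map_one]
    simp
  have hy2 : ‖y‖ ^ 2 ≤ 1 - m := by
    have hFm : MeasurableSet F := hF.measurableSet
    rw [hy, norm_sq_unitaryCalculus_apply]
    calc ∫ z, ‖(1 - f) z‖ ^ 2 ∂μ ≤ ∫ z, Fᶜ.indicator (fun _ => (1 : ℝ)) z ∂μ := by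
          refine integral_mono_of_nonneg (Eventually.of_forall fun z => sq_nonneg _)
            ((integrable_const _).indicator hFm.compl) (Eventually.of_forall fun z => ?_)
          have h1 : ‖(1 - f) z‖ = 1 - u z := by
            have h2 : (1 - f) z = ((1 - u z : ℝ) : ℂ) := by simp [hf]
            rw [h2, Complex.norm_real, Real.norm_of_nonneg (sub_nonneg.2 (hu z).2)]
          simp only [h1]
          by_cases hz : z ∈ F
          · simp [hu1 hz, hz]
          · rw [indicator_of_mem (mem_compl hz)]
            exact pow_le_one₀ (sub_nonneg.2 (hu z).2) (by linarith [(hu z).1])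
      _ = μ.real univ - μ.real F := by
          rw [integral_indicator_const _ hFm.compl, measureReal_compl hFm, smul_eq_mul, mul_one]
      _ ≤ 1 - m := by
          rw [measureReal_spectralMeasure_univ, hψ]
          linarith
  have hx2 : ∀ n : A, ∑ k ∈ Finset.range K, ‖inner ℂ (b n) (((U : H →L[ℂ] H) ^ k) x)‖ ^ 2 ≤
      c * (Real.exp (4 * Real.pi) * K) := by
    intro n
    have := sum_norm_inner_pow_unitaryCalculus_sq_le U ψ hK hc f hfn
      (fun z hz => by simp [hf, hu0 hz]) (b n)
    rwa [b.orthonormal.1 n, one_pow, mul_one] at this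
  -- `|p + q|² ≤ (1 + t) |q|² + (1 + 1 / t) |p|²`
  have hprob : ∀ (n : A) k, prob b U ψ n k ≤
      (1 + t) * ‖inner ℂ (b n) (((U : H →L[ℂ] H) ^ k) y)‖ ^ 2 +
        (1 + 1 / t) * ‖inner ℂ (b n) (((U : H →L[ℂ] H) ^ k) x)‖ ^ 2 := by
    intro n k
    rw [prob, ← hxy, map_add, inner_add_right]
    set p := (inner ℂ (b n) (((U : H →L[ℂ] H) ^ k) x) : ℂ)
    set q := (inner ℂ (b n) (((U : H →L[ℂ] H) ^ k) y) : ℂ)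
    have h1 : ‖p + q‖ ^ 2 ≤ (‖p‖ + ‖q‖) ^ 2 :=
      pow_le_pow_left₀ (norm_nonneg _) (norm_add_le p q) 2
    have h2 : (1 + t) * ‖q‖ ^ 2 + (1 + 1 / t) * ‖p‖ ^ 2 - (‖p‖ + ‖q‖) ^ 2 =
        (t * ‖q‖ - ‖p‖) ^ 2 / t := by
      field_simp
      ring
    have h3 : 0 ≤ (t * ‖q‖ - ‖p‖) ^ 2 / t := by positivity
    linarith
  have hbessel : ∀ k, ∑ n ∈ Λ, ‖inner ℂ (b n) (((U : H →L[ℂ] H) ^ k) y)‖ ^ 2 ≤ 1 - m := fun k =>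
    (b.orthonormal.sum_inner_products_le _).trans (by rwa [norm_pow_unitary_apply])
  calc ∑ n ∈ Λ, avgProb b U ψ n K
      ≤ ∑ n ∈ Λ, (1 / (K : ℝ)) * ∑ k ∈ Finset.range K,
          ((1 + t) * ‖inner ℂ (b n) (((U : H →L[ℂ] H) ^ k) y)‖ ^ 2 +
            (1 + 1 / t) * ‖inner ℂ (b n) (((U : H →L[ℂ] H) ^ k) x)‖ ^ 2) := by
        unfold avgProb
        gcongr with n _ k _
        exact hprob n k
    _ = (1 / (K : ℝ)) * ((1 + t) * ∑ k ∈ Finset.range K, ∑ n ∈ Λ,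
          ‖inner ℂ (b n) (((U : H →L[ℂ] H) ^ k) y)‖ ^ 2 +
        (1 + 1 / t) * ∑ n ∈ Λ, ∑ k ∈ Finset.range K,
          ‖inner ℂ (b n) (((U : H →L[ℂ] H) ^ k) x)‖ ^ 2) := by
        rw [← Finset.mul_sum, Finset.sum_comm (s := Finset.range K)]
        simp only [Finset.sum_add_distrib, Finset.mul_sum]
    _ ≤ (1 / (K : ℝ)) * ((1 + t) * ∑ k ∈ Finset.range K, (1 - m) +
        (1 + 1 / t) * ∑ n ∈ Λ, c * (Real.exp (4 * Real.pi) * K)) := by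
        gcongr with k _ n _
        · exact hbessel k
        · exact hx2 n
    _ = _ := by
        rw [Finset.sum_const, Finset.sum_const, Finset.card_range, nsmul_eq_mul, nsmul_eq_mul]
        field_simp

/-! ### Moments and the transport exponent -/

theorem avgProb_nonneg (b : HilbertBasis A ℂ H) (U : unitary (H →L[ℂ] H)) (ψ : H) (n : A)
    (K : ℕ) : 0 ≤ avgProb b U ψ n K :=
  mul_nonneg (by positivity) (Finset.sum_nonneg fun _ _ => sq_nonneg _)

theorem l1Norm_nonneg (n : Fin d → ℤ) : 0 ≤ l1Norm n :=
  Finset.sum_nonneg fun _ _ => abs_nonneg _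

theorem tsum_ofReal_avgProb (b : HilbertBasis A ℂ H) (U : unitary (H →L[ℂ] H)) {ψ : H}
    (hψ : ‖ψ‖ = 1) {K : ℕ} (hK : 0 < K) : ∑' n : A, ENNReal.ofReal (avgProb b U ψ n K) = 1 := by
  have hK' : (K : ℝ) ≠ 0 := by positivity
  have h1 : ∀ k, HasSum (fun n : A => prob b U ψ n k) 1 := by
    intro k
    set x := ((U : H →L[ℂ] H) ^ k) ψ with hx
    have h2 := b.hasSum_inner_mul_inner x x
    have h3 : (inner ℂ x x : ℂ) = ((1 : ℝ) : ℂ) := by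
      rw [inner_self_eq_norm_sq_to_K, hx, norm_pow_unitary_apply, hψ]
      simp
    rw [h3] at h2
    refine Complex.hasSum_ofReal.1 (h2.congr_fun fun n => ?_)
    rw [prob, ← hx, ← inner_conj_symm x, Complex.conj_mul']
    simp
  have h4 : HasSum (fun n : A => avgProb b U ψ n K) 1 := by
    have h5 := (hasSum_sum fun k (_ : k ∈ Finset.range K) => h1 k).mul_left (1 / (K : ℝ))
    simpa [avgProb, hK'] using h5
  rw [← ENNReal.ofReal_tsum_of_nonneg (fun n => avgProb_nonneg b U ψ n K) h4.summable, h4.tsum_eq,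
    ENNReal.ofReal_one]

theorem one_le_avgMoment (b : HilbertBasis A ℂ H) (U : unitary (H →L[ℂ] H)) {ψ : H}
    (hψ : ‖ψ‖ = 1) (p : ℝ) {K : ℕ} (hK : 0 < K) : 1 ≤ avgMoment b U ψ p K := by
  rw [← tsum_ofReal_avgProb b U hψ hK]
  refine ENNReal.tsum_le_tsum fun n => ENNReal.ofReal_le_ofReal ?_
  refine le_mul_of_one_le_left (avgProb_nonneg b U ψ n K) ?_
  linarith [Real.rpow_nonneg (l1Norm_nonneg (n : Fin d → ℤ)) p]

/-- If the time-averaged probability of `Λ` is at most `q`, and the sites outside `Λ` have distance at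
least `R` from the origin, then the moment is at least `R^p (1 - q)`. As the moment may be infinite,
the part inside `Λ` is added to both sides. -/
theorem ofReal_rpow_mul_le_avgMoment (b : HilbertBasis A ℂ H) (U : unitary (H →L[ℂ] H)) {ψ : H}
    (hψ : ‖ψ‖ = 1) {p : ℝ} (hp : 0 ≤ p) {K : ℕ} (hK : 0 < K) {R q : ℝ} (hR : 0 ≤ R)
    (Λ : Finset A) (hΛ : ∀ n ∉ Λ, R ≤ l1Norm (n : Fin d → ℤ))
    (hq : ∑ n ∈ Λ, avgProb b U ψ n K ≤ q) :
    ENNReal.ofReal (R ^ p * (1 - q)) ≤ avgMoment b U ψ p K := by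
  have hRp := Real.rpow_nonneg hR p
  have h1 : ENNReal.ofReal (R ^ p) ≤ avgMoment b U ψ p K + ENNReal.ofReal (R ^ p * q) := by
    calc ENNReal.ofReal (R ^ p)
        = ∑' n : A, ENNReal.ofReal (R ^ p) * ENNReal.ofReal (avgProb b U ψ n K) := by
          rw [ENNReal.tsum_mul_left, tsum_ofReal_avgProb b U hψ hK, mul_one]
      _ ≤ ∑' n : A, (ENNReal.ofReal ((l1Norm (n : Fin d → ℤ) ^ p + 1) * avgProb b U ψ n K) +
            (Λ : Set A).indicator (fun n => ENNReal.ofReal (R ^ p * avgProb b U ψ n K)) n) := by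
          refine ENNReal.tsum_le_tsum fun n => ?_
          rw [← ENNReal.ofReal_mul hRp]
          by_cases hn : n ∈ Λ
          · rw [indicator_of_mem (Finset.mem_coe.2 hn)]
            exact le_add_self
          · refine le_add_right (ENNReal.ofReal_le_ofReal
              (mul_le_mul_of_nonneg_right ?_ (avgProb_nonneg b U ψ n K)))
            linarith [Real.rpow_le_rpow hR (hΛ n hn) hp]
      _ = avgMoment b U ψ p K + ENNReal.ofReal (∑ n ∈ Λ, R ^ p * avgProb b U ψ n K) := by
          rw [ENNReal.tsum_add, ← sum_eq_tsum_indicator, ENNReal.ofReal_sum_of_nonneg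
            fun n _ => mul_nonneg hRp (avgProb_nonneg b U ψ n K)]
          rfl
      _ ≤ _ := by
          rw [← Finset.mul_sum]
          gcongr
  have hq0 : 0 ≤ q := (Finset.sum_nonneg fun n _ => avgProb_nonneg b U ψ n K).trans hq
  rw [mul_sub, mul_one, ENNReal.ofReal_sub _ (by positivity)]
  exact tsub_le_iff_right.2 h1

open Classical in
/-- The sites of `A` in the cube of side length `2 N + 1` around the origin. -/
noncomputable def box (A : Set (Fin d → ℤ)) (N : ℕ) : Finset A :=
  (Fintype.piFinset fun _ : Fin d => Finset.Icc (-(N : ℤ)) N).subtype (· ∈ A)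

theorem card_box_le (A : Set (Fin d → ℤ)) (N : ℕ) : (box A N).card ≤ (2 * N + 1) ^ d := by
  classical
  rw [box, Finset.card_subtype]
  refine (Finset.card_filter_le _ _).trans_eq ?_
  rw [Fintype.card_piFinset]
  simp only [Int.card_Icc, Finset.prod_const, Finset.card_univ, Fintype.card_fin]
  congr 1
  omega

theorem le_l1Norm_of_notMem_box {N : ℕ} {n : A} (hn : n ∉ box A N) :
    (N : ℝ) + 1 ≤ l1Norm (n : Fin d → ℤ) := by
  simp only [box, Finset.mem_subtype, Fintype.mem_piFinset, Finset.mem_Icc, not_forall,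
    ← abs_le, not_le] at hn
  obtain ⟨i, hi⟩ := hn
  calc (N : ℝ) + 1 ≤ |((n : Fin d → ℤ) i : ℝ)| := by exact_mod_cast hi
    _ ≤ _ := Finset.single_le_sum (f := fun i => |((n : Fin d → ℤ) i : ℝ)|)
      (fun _ _ => abs_nonneg _) (Finset.mem_univ i)

theorem eventually_mul_pow_le_rpow (C : ℝ) {η : ℝ} (hη : 0 < η) :
    ∀ᶠ j : ℕ in atTop, C * ((j : ℝ) + 1) ^ 4 ≤ (2 : ℝ) ^ (j * η) := by
  set r : ℝ := 2 ^ η with hr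
  have hr1 : 1 < r := Real.one_lt_rpow one_lt_two hη
  have hr0 : 0 < r := zero_lt_one.trans hr1
  have h1 := (tendsto_pow_const_div_const_pow_of_one_lt 4 hr1).comp (tendsto_add_atTop_nat 1)
  have h2 := h1.const_mul (C * r)
  rw [mul_zero] at h2
  filter_upwards [h2.eventually (gt_mem_nhds one_pos)] with j hj
  have h3 : (2 : ℝ) ^ (j * η) = r ^ j := by
    rw [hr, mul_comm, Real.rpow_mul two_pos.le, Real.rpow_natCast]
  rw [h3]
  simp only [Function.comp_apply, Nat.cast_add, Nat.cast_one] at hj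
  rw [← mul_div_assoc, div_lt_one (by positivity), pow_succ r] at hj
  refine le_of_mul_le_mul_right (?_ : _ * r ≤ _ * r) hr0
  linarith

/-- Quantitative lower bound for the moments along infinitely many dyadic times. At time `2 ^ j`
the box of side length about `2 ^ (j β / d)`, with `γ < β < α`, carries at most the probability
`1 - 1 / (4 (j + 1)²)`. -/
theorem frequently_rpow_le_avgMoment (hd : 1 ≤ d) (b : HilbertBasis A ℂ H)
    (U : unitary (H →L[ℂ] H)) {ψ : H} (hψ : ‖ψ‖ = 1) {p : ℝ} (hp : 0 < p) {α : ℝ≥0} {γ : ℝ}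
    (hγ0 : 0 ≤ γ) (hγ : γ < α) (hα : α < upperPackingDim (spectralMeasure U ψ)) :
    ∃ᶠ j : ℕ in atTop,
      ENNReal.ofReal (2 ^ (γ / d * p * j : ℝ)) ≤ avgMoment b U ψ p (2 ^ j) := by
  have hd' : (0 : ℝ) < d := by exact_mod_cast hd
  obtain ⟨β, hγβ, hβα⟩ := exists_between hγ
  have hβ0 : 0 ≤ β := hγ0.trans hγβ.le
  have hev1 := eventually_mul_pow_le_rpow (12 * 3 ^ d * Real.exp (4 * Real.pi)) (sub_pos.2 hβα)
  have hev2 := eventually_mul_pow_le_rpow 4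
    (show 0 < (β - γ) / d * p from mul_pos (div_pos (sub_pos.2 hγβ) hd') hp)
  refine ((frequently_lt_measureReal_compl_heavySet hα).and_eventually (hev1.and hev2)).mono ?_
  rintro j ⟨hm, h1, h2⟩
  set E := Real.exp (4 * Real.pi) with hE
  have hE0 : 0 < E := Real.exp_pos _
  set m : ℝ := 1 / ((j : ℝ) + 1) ^ 2 with hmdef
  have hj1 : (1 : ℝ) ≤ (j : ℝ) + 1 := by linarith [(Nat.cast_nonneg j : (0 : ℝ) ≤ j)]
  have hm0 : 0 < m := by positivity
  have hm1 : m ≤ 1 := by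
    rw [hmdef, div_le_one (by positivity)]
    exact one_le_pow₀ hj1
  set X : ℝ := 2 ^ (j * β / d) with hX
  have hX1 : 1 ≤ X := Real.one_le_rpow one_le_two (by positivity)
  set N := ⌊X⌋₊ with hN
  set c : ℝ := (2 ^ j : ℝ) ^ (-(α : ℝ)) with hc
  have hc0 : 0 ≤ c := by positivity
  -- With `t = m / 2`, the contribution of `(1 - f)(U) ψ` is at most `(1 + m / 2) (1 - m) ≤ 1 - m / 2`.
  have hq := sum_avgProb_le b U hψ (K := 2 ^ j) (by positivity) hc0 hm0.le (half_pos hm0) hm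
    (box A N)
  have hcard : ((box A N).card : ℝ) ≤ 3 ^ d * 2 ^ (j * β) := by
    calc ((box A N).card : ℝ) ≤ (2 * N + 1) ^ d := by exact_mod_cast card_box_le A N
      _ ≤ (3 * X) ^ d := by
          gcongr
          linarith [Nat.floor_le (zero_le_one.trans hX1)]
      _ = 3 ^ d * 2 ^ (j * β) := by
          rw [mul_pow, hX, ← Real.rpow_natCast ((2 : ℝ) ^ (j * β / d)), ← Real.rpow_mul two_pos.le,
            div_mul_cancel₀ _ hd'.ne']
  have hsmall : (box A N).card * (c * E) ≤ m ^ 2 / 12 := by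
    have hcE : 0 ≤ c * E := by positivity
    have hexp : (2 : ℝ) ^ (j * β) * c * 2 ^ (j * (α - β)) = 1 := by
      rw [hc, ← Real.rpow_natCast, ← Real.rpow_mul two_pos.le, ← Real.rpow_add two_pos,
        ← Real.rpow_add two_pos]
      ring_nf
      exact Real.rpow_zero 2
    have hY : 0 < (2 : ℝ) ^ (j * (α - β)) := by positivity
    refine (mul_le_mul_of_nonneg_right hcard hcE).trans ?_
    rw [le_div_iff₀ (by norm_num), hmdef, div_pow, one_pow, ← pow_mul, le_div_iff₀ (by positivity)]
    calc 3 ^ d * 2 ^ (j * β) * (c * E) * 12 * ((j : ℝ) + 1) ^ (2 * 2)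
        = (2 ^ (j * β) * c) * (12 * 3 ^ d * E * ((j : ℝ) + 1) ^ 4) := by ring
      _ ≤ (2 ^ (j * β) * c) * 2 ^ (j * (α - β)) := by gcongr
      _ = 1 := hexp
  have hq' : ∑ n ∈ box A N, avgProb b U ψ n (2 ^ j) ≤ 1 - m / 4 := by
    refine hq.trans ?_
    have h3 : (1 + 1 / (m / 2)) * ((box A N).card * (c * E)) ≤ m / 4 := by
      calc _ ≤ (1 + 1 / (m / 2)) * (m ^ 2 / 12) := by gcongr
        _ = (m ^ 2 + 2 * m) / 12 := by
            field_simp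
        _ ≤ m / 4 := by nlinarith
    nlinarith
  refine le_trans (ENNReal.ofReal_le_ofReal ?_) (ofReal_rpow_mul_le_avgMoment b U hψ hp.le
    (by positivity) (zero_le_one.trans hX1) (box A N) (fun n hn => ?_) hq')
  · have h4 : (4 : ℝ) * ((j : ℝ) + 1) ^ 2 ≤ 2 ^ (j * ((β - γ) / d * p)) :=
      (mul_le_mul_of_nonneg_left (pow_le_pow_right₀ hj1 (by norm_num)) (by norm_num)).trans h2
    have h5 : X ^ p = 2 ^ (γ / d * p * j) * 2 ^ (j * ((β - γ) / d * p)) := by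
      rw [hX, ← Real.rpow_mul two_pos.le, ← Real.rpow_add two_pos]
      congr 1
      ring
    have h6 : 1 - (1 - m / 4) = 1 / (4 * ((j : ℝ) + 1) ^ 2) := by
      rw [hmdef]
      field_simp
      ring
    rw [h5, h6, mul_one_div, le_div_iff₀ (by positivity)]
    gcongr
  · exact (Nat.lt_floor_add_one X).le.trans (le_l1Norm_of_notMem_box hn)

theorem div_le_upperTransportExponent (hd : 1 ≤ d) (b : HilbertBasis A ℂ H)
    (U : unitary (H →L[ℂ] H)) {ψ : H} (hψ : ‖ψ‖ = 1) {p : ℝ} (hp : 0 < p) {α : ℝ≥0} {γ : ℝ}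
    (hγ0 : 0 ≤ γ) (hγ : γ < α) (hα : α < upperPackingDim (spectralMeasure U ψ)) :
    ((γ / d : ℝ) : EReal) ≤ upperTransportExponent b U ψ p := by
  refine le_limsup_of_frequently_le' ?_
  refine (tendsto_pow_atTop_atTop_of_one_lt (one_lt_two : (1 : ℕ) < 2)).frequently ?_
  refine ((frequently_rpow_le_avgMoment hd b U hψ hp hγ0 hγ hα).and_eventually
    (eventually_gt_atTop 0)).mono ?_
  rintro j ⟨hj, hj0⟩
  have hlog : Real.log ((2 ^ j : ℕ) : ℝ) = j * Real.log 2 := by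
    rw [Nat.cast_pow, Real.log_pow, Nat.cast_ofNat]
  have hpos : 0 < p * Real.log ((2 ^ j : ℕ) : ℝ) := by
    rw [hlog]
    have := Real.log_pos one_lt_two
    positivity
  rw [EReal.le_div_iff_mul_le (by exact_mod_cast hpos) (EReal.coe_ne_top _)]
  refine le_trans (le_of_eq ?_) (ENNReal.log_monotone hj)
  rw [ENNReal.log_ofReal_of_pos (by positivity), Real.log_rpow two_pos, hlog, ← EReal.coe_mul]
  congr 1
  ring

theorem upperTransportExponent_nonneg (b : HilbertBasis A ℂ H) (U : unitary (H →L[ℂ] H)) {ψ : H}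
    (hψ : ‖ψ‖ = 1) {p : ℝ} (hp : 0 < p) : 0 ≤ upperTransportExponent b U ψ p := by
  refine le_limsup_of_frequently_le' (Eventually.frequently ?_)
  filter_upwards [eventually_gt_atTop 1] with K hK
  have hpos : 0 < p * Real.log (K : ℝ) := mul_pos hp (Real.log_pos (by exact_mod_cast hK))
  refine EReal.div_nonneg ?_ (by exact_mod_cast hpos.le)
  rw [← ENNReal.log_one]
  exact ENNReal.log_monotone (one_le_avgMoment b U hψ p (zero_lt_one.trans hK))

end Transport

end UnitaryTransport

theorem mainTheorem3 {H : Type*} [NormedAddCommGroup H] [InnerProductSpace ℂ H] [CompleteSpace H]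
    {d : ℕ} (hd : 1 ≤ d) (A : Set (Fin d → ℤ))
    (hA : A = Set.univ ∨ A = {n | ∀ i, 0 ≤ n i} ∨ A = {n | ∀ i, 1 ≤ n i})
    (b : HilbertBasis A ℂ H) (U : unitary (H →L[ℂ] H)) (ψ : H) (hψ : ‖ψ‖ = 1)
    (p : ℝ) (hp : 0 < p) :
    ((UnitaryTransport.upperPackingDim (UnitaryTransport.spectralMeasure U ψ) / (d : ℝ≥0∞) :
        ℝ≥0∞) : EReal) ≤ UnitaryTransport.upperTransportExponent b U ψ p := by
  have hd0 : (d : ℝ≥0) ≠ 0 := by exact_mod_cast (Nat.one_le_iff_ne_zero.1 hd)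
  -- The bound is proved for every `a` below the quotient, with `γ = a d`.
  refine le_of_forall_lt_imp_le_of_dense fun a ha => ?_
  rcases lt_or_ge a 0 with h0 | h0
  · exact h0.le.trans (UnitaryTransport.upperTransportExponent_nonneg b U hψ hp)
  lift a to ℝ≥0∞ using h0
  rw [EReal.coe_ennreal_lt_coe_ennreal_iff] at ha
  lift a to ℝ≥0 using ha.ne_top
  rw [ENNReal.lt_div_iff_mul_lt (Or.inl (by exact_mod_cast hd0)) (Or.inl (ENNReal.natCast_ne_top d))]
    at ha
  obtain ⟨α, hα1, hα2⟩ := ENNReal.lt_iff_exists_nnreal_btwn.1 ha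
  have hγ : a * d < α := by exact_mod_cast hα1
  have h := UnitaryTransport.div_le_upperTransportExponent hd b U hψ hp (γ := (a * d : ℝ≥0))
    (NNReal.coe_nonneg _) (by exact_mod_cast hγ) hα2
  refine le_trans (le_of_eq ?_) h
  have hdiv : ((a * d : ℝ≥0) : ℝ) / d = a := by
    push_cast
    exact mul_div_cancel_right₀ _ (by exact_mod_cast hd0)
  rw [hdiv]
  rfl
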